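/- A Banach space $X$ (over $\mathbb K=\mathbb R$ or $\mathbb C$) has the weak fixed point property if, for every nonempty, weakly compact, convex subset $C$ of $X$, every nonexpansive mapping $T:C\to C$ (that is, $\|Tx-Ty\|\le\|x-y\|$ for all $x,y\in C$) has a fixed point. The dual $X^*$ has the weak$^*$ uniform Kadec--Klee property if for every $\varepsilon>0$ there is $\delta>0$ such that, whenever $(x_n^*)$ is a sequence in the closed unit ball $B_{X^*}$ converging weak$^*$ to $x^*$ with $\inf\{\|x_n^*-x_m^*\| : m\ne n\}>\varepsilon$, one has $\|x^*\|<1-\delta$. Let $X$ be a Banach space such that $B_{X^*}$ is weak$^*$ sequentially compact. If $X^*$ has the weak$^*$ uniform Kadec--Klee property and $Y$ is a closed subspace of $X$, then the quotient $X/Y$ (with the quotient norm) has the weak fixed point property. In particular, for every closed subspace $Z$ of $c_0$ (the space of null sequences in $\mathbb K$ with the supremum norm), the quotient $c_0/Z$ has the weak fixed point property. -/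

import Mathlib

open Filter Topology Metric
open scoped ZeroAtInfty

/-- The separation constant `inf {‖x n - x m‖ : m ≠ n}` of a sequence. -/
noncomputable def sepConst {E : Type*} [NormedAddCommGroup E] (x : ℕ → E) : ℝ :=
  sInf {r : ℝ | ∃ m n : ℕ, m ≠ n ∧ r = ‖x n - x m‖}

/-- The closed unit ball of the dual `X*` is weak* sequentially compact. -/
def DualBallWeakStarSeqCompact (𝕜 X : Type*) [RCLike 𝕜] [NormedAddCommGroup X]
    [NormedSpace 𝕜 X] : Prop :=
  IsSeqCompact (WeakDual.toStrongDual ⁻¹' closedBall (0 : StrongDual 𝕜 X) 1)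

/-- The dual `X*` of `X` has the weak* uniform Kadec–Klee property. -/
def DualWeakStarUKK (𝕜 X : Type*) [RCLike 𝕜] [NormedAddCommGroup X]
    [NormedSpace 𝕜 X] : Prop :=
  ∀ ε : ℝ, 0 < ε → ∃ δ : ℝ, 0 < δ ∧
    ∀ (f : ℕ → StrongDual 𝕜 X) (g : StrongDual 𝕜 X),
      (∀ n, f n ∈ closedBall (0 : StrongDual 𝕜 X) 1) →
      Tendsto (fun n => StrongDual.toWeakDual (f n)) atTop (𝓝 (StrongDual.toWeakDual g)) →
      ε < sepConst f →
      ‖g‖ < 1 - δ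

/-- The weak fixed point property: every nonexpansive self-map of a nonempty, weakly compact,
convex set has a fixed point. -/
def WeakFixedPointProperty (𝕜 E : Type*) [RCLike 𝕜] [NormedAddCommGroup E]
    [NormedSpace 𝕜 E] [NormedSpace ℝ E] [IsScalarTower ℝ 𝕜 E] : Prop :=
  ∀ C : Set E, C.Nonempty → IsCompact (toWeakSpace 𝕜 E '' C) → Convex ℝ C →
    ∀ T : C → C, LipschitzWith 1 T → ∃ x : C, T x = x

/-! The bridge is a García-Falset-type bound in `E = X ⧸ Y`: for some `η > 0`, a weakly null `u` and
a point `y` in the unit ball cannot satisfy `‖u n + y‖ > 2 - η` for all `n`. Otherwise functionals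
norming `u n + y` nearly norm both `u n` and `y`; pulled back to `X`, a subsequence is separated
while its weak* limit still nearly norms a lift of `y`, against UKK
(`exists_norm_add_le_of_dualWeakStarUKK`).

The bound yields fixed points (`weakFixedPointProperty_of_exists_norm_add_le`): in a minimal
invariant set of diameter `d > 0` it produces approximate fixed points within `(2 - η) * (d / 2) <
d` of one point of the set, which the Goebel–Karlovitz lemma `norm_sub_le_of_approx_fixed` forbids.
Ultrafilter limits replace weakly convergent subsequences. For `c₀`, UKK comes from the
`ℓ₁`-additivity of the dual norm. -/

/-! ### Weakly compact sets and weak limits. -/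

section WeakTopology

variable {𝕜 E : Type*} [RCLike 𝕜] [NormedAddCommGroup E] [NormedSpace 𝕜 E]

/-- A sequence in a weakly compact set converges weakly along any ultrafilter. -/
theorem exists_weak_limit_of_isCompact {K : Set E} (hK : IsCompact (toWeakSpace 𝕜 E '' K))
    {ι : Type*} (U : Ultrafilter ι) (u : ι → E) (hu : ∀ n, u n ∈ K) :
    ∃ y ∈ K, ∀ f : StrongDual 𝕜 E, Tendsto (fun n => f (u n)) U (𝓝 (f y)) := by
  obtain ⟨y', ⟨y, hy, rfl⟩, hlim⟩ := hK.ultrafilter_le_nhds (U.map fun n => toWeakSpace 𝕜 E (u n))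
    (by
      rw [le_principal_iff]
      exact Ultrafilter.mem_map.2 (Filter.mem_of_superset Filter.univ_mem
        fun n _ => ⟨u n, hu n, rfl⟩))
  refine ⟨y, hy, fun f => ?_⟩
  have hc : Continuous fun x : WeakSpace 𝕜 E => f ((toWeakSpace 𝕜 E).symm x) :=
    WeakBilin.eval_continuous (topDualPairing 𝕜 E).flip f
  exact (hc.tendsto (toWeakSpace 𝕜 E y)).comp hlim

/-- Weak lower semicontinuity of the norm. -/
theorem norm_le_of_weak_limit {ι : Type*} {l : Filter ι} [l.NeBot] {u : ι → E} {y : E} {r : ℝ}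
    (hlim : ∀ f : StrongDual 𝕜 E, Tendsto (fun n => f (u n)) l (𝓝 (f y)))
    (hr : ∀ ε > 0, ∀ᶠ n in l, ‖u n‖ ≤ r + ε) : ‖y‖ ≤ r := by
  obtain ⟨f, hf, hfy⟩ := exists_dual_vector'' 𝕜 y
  refine le_of_forall_pos_le_add fun ε hε => ?_
  have h1 : ‖f y‖ = ‖y‖ := by rw [hfy]; simp
  rw [← h1]
  refine le_of_tendsto (hlim f).norm ((hr ε hε).mono fun n hn => ?_)
  exact (f.le_of_opNorm_le hf _).trans (by simpa using hn)

/-- Weakly compact sets are bounded. -/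
theorem isBounded_of_isCompact_toWeakSpace {K : Set E}
    (hK : IsCompact (toWeakSpace 𝕜 E '' K)) : Bornology.IsBounded K := by
  obtain ⟨M, hM⟩ := banach_steinhaus (E := StrongDual 𝕜 E) (F := 𝕜)
    (g := fun x : K => NormedSpace.inclusionInDoubleDual 𝕜 E x) (fun f => by
      have hc : Continuous fun x : WeakSpace 𝕜 E => f ((toWeakSpace 𝕜 E).symm x) :=
        WeakBilin.eval_continuous (topDualPairing 𝕜 E).flip f
      obtain ⟨M, hM⟩ := (hK.image hc).isBounded.exists_norm_le
      refine ⟨M, fun x => hM _ ⟨_, ⟨x, x.2, rfl⟩, rfl⟩⟩)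
  refine isBounded_iff_forall_norm_le.2 ⟨M, fun x hx => ?_⟩
  have h := hM ⟨x, hx⟩
  obtain ⟨f, hf, hfy⟩ := exists_dual_vector'' 𝕜 x
  have h1 : ‖f x‖ = ‖x‖ := by rw [hfy]; simp
  have h2 := (NormedSpace.inclusionInDoubleDual 𝕜 E x).le_of_opNorm_le h f
  rw [NormedSpace.dual_def, h1] at h2
  have h3 : 0 ≤ M := (norm_nonneg _).trans h
  nlinarith [norm_nonneg f]

theorem isClosed_of_isCompact_toWeakSpace {K : Set E}
    (hK : IsCompact (toWeakSpace 𝕜 E '' K)) : IsClosed K := by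
  have h := hK.isClosed.preimage (toWeakSpaceCLM 𝕜 E).continuous
  convert h using 1
  ext x
  constructor
  · intro hx
    exact ⟨x, hx, rfl⟩
  · rintro ⟨y, hy, hyx⟩
    have : y = x := (toWeakSpace 𝕜 E).injective hyx
    exact this ▸ hy

variable [NormedSpace ℝ E] [IsScalarTower ℝ 𝕜 E]

theorem isClosed_toWeakSpace_image {K : Set E} (hK : IsClosed K) (hc : Convex ℝ K) :
    IsClosed (toWeakSpace 𝕜 E '' K) := by
  rw [← closure_eq_iff_isClosed, ← hc.toWeakSpace_closure 𝕜, hK.closure_eq]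

end WeakTopology

/-! ### Minimal invariant sets and the Goebel–Karlovitz lemma. -/

section MinimalSets

variable {E : Type*} [NormedAddCommGroup E] [NormedSpace ℝ E]

/-- Nonempty closed convex subsets of `C` that are mapped into themselves by `T`. -/
structure IsInvariantSubset (T : E → E) (C K : Set E) : Prop where
  subset : K ⊆ C
  nonempty : K.Nonempty
  isClosed : IsClosed K
  convex : Convex ℝ K
  mapsTo : Set.MapsTo T K K

theorem exists_minimal_invariantSubset (𝕜 : Type*) [RCLike 𝕜] [NormedSpace 𝕜 E]
    [IsScalarTower ℝ 𝕜 E] {T : E → E} {C : Set E} (hne : C.Nonempty)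
    (hC : IsCompact (toWeakSpace 𝕜 E '' C)) (hconv : Convex ℝ C) (hT : Set.MapsTo T C C) :
    ∃ K, Minimal (IsInvariantSubset T C) K := by
  have hC' : IsInvariantSubset T C C :=
    ⟨subset_rfl, hne, isClosed_of_isCompact_toWeakSpace hC, hconv, hT⟩
  obtain ⟨K, -, hK⟩ := zorn_superset_nonempty {K | IsInvariantSubset T C K} (fun c hc hch hcne => by
    have hdir : DirectedOn (· ⊇ ·) c := by
      intro a ha b hb
      rcases hch.total ha hb with h | h
      · exact ⟨a, ha, subset_rfl, h⟩
      · exact ⟨b, hb, h, subset_rfl⟩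
    have hnonempty : (⋂₀ c).Nonempty := by
      have hcl : ∀ K ∈ c, IsClosed (toWeakSpace 𝕜 E '' K) := fun K hK =>
        isClosed_toWeakSpace_image (hc hK).isClosed (hc hK).convex
      have : Nonempty ((fun K => toWeakSpace 𝕜 E '' K) '' c) := (hcne.image _).to_subtype
      obtain ⟨x, hx⟩ := IsCompact.nonempty_sInter_of_directed_nonempty_isCompact_isClosed
        (S := (fun K => toWeakSpace 𝕜 E '' K) '' c)
        (by
          rintro _ ⟨a, ha, rfl⟩ _ ⟨b, hb, rfl⟩
          obtain ⟨d, hd, h1, h2⟩ := hdir a ha b hb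
          exact ⟨_, ⟨d, hd, rfl⟩, Set.image_mono h1, Set.image_mono h2⟩)
        (by rintro _ ⟨a, ha, rfl⟩; exact (hc ha).nonempty.image _)
        (by
          rintro _ ⟨a, ha, rfl⟩
          exact hC.of_isClosed_subset (hcl a ha) (Set.image_mono (hc ha).subset))
        (by rintro _ ⟨a, ha, rfl⟩; exact hcl a ha)
      refine ⟨(toWeakSpace 𝕜 E).symm x, fun K hK => ?_⟩
      obtain ⟨y, hy, rfl⟩ := hx _ ⟨K, hK, rfl⟩
      simpa using hy
    refine ⟨⋂₀ c, ⟨?_, hnonempty, ?_, ?_, ?_⟩, fun s hs => Set.sInter_subset_of_mem hs⟩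
    · obtain ⟨K, hK⟩ := hcne
      exact (Set.sInter_subset_of_mem hK).trans (hc hK).subset
    · exact isClosed_sInter fun K hK => (hc hK).isClosed
    · exact convex_sInter fun K hK => (hc hK).convex
    · exact fun x hx K hK => (hc hK).mapsTo (hx K hK)) C hC'
  exact ⟨K, hK⟩

theorem convex_setOf_norm_sub_le (x : E) (r : ℝ) : Convex ℝ {u : E | ‖u - x‖ ≤ r} := by
  have := convex_closedBall x r
  simpa only [closedBall, dist_eq_norm] using this

theorem Minimal.eq_of_invariantSubset {T : E → E} {C K : Set E}
    (hK : Minimal (IsInvariantSubset T C) K) {L : Set E} (hLK : L ⊆ K) (hne : L.Nonempty)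
    (hcl : IsClosed L) (hconv : Convex ℝ L) (hmaps : Set.MapsTo T L L) : L = K :=
  hLK.antisymm (hK.2 ⟨hLK.trans hK.1.subset, hne, hcl, hconv, hmaps⟩ hLK)

/-- Minimal invariant sets are diametral. -/
theorem norm_sub_le_of_minimal {T : E → E} {C K : Set E}
    (hK : Minimal (IsInvariantSubset T C) K) (hT : ∀ x ∈ C, ∀ y ∈ C, ‖T x - T y‖ ≤ ‖x - y‖)
    {y : E} (hy : y ∈ K) {r : ℝ} (hr : ∀ u ∈ K, ‖u - y‖ ≤ r) :
    ∀ u ∈ K, ∀ v ∈ K, ‖u - v‖ ≤ r := by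
  have hCK := hK.1.subset
  have key : K ∩ ⋂ u ∈ K, {x | ‖x - u‖ ≤ r} = K := by
    refine hK.eq_of_invariantSubset Set.inter_subset_left
      ⟨y, hy, Set.mem_iInter₂.2 fun u hu => (norm_sub_rev y u).trans_le (hr u hu)⟩ ?_ ?_ ?_
    · exact hK.1.isClosed.inter
        (isClosed_biInter fun u _ => isClosed_le (by fun_prop) (by fun_prop))
    · exact hK.1.convex.inter (convex_iInter₂ fun u _ => convex_setOf_norm_sub_le u r)
    · rintro x ⟨hx, hxr⟩
      replace hxr : ∀ u ∈ K, ‖x - u‖ ≤ r := fun u hu => Set.mem_iInter₂.1 hxr u hu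
      have hTx := hK.1.mapsTo hx
      refine ⟨hTx, Set.mem_iInter₂.2 ?_⟩
      have hL : ∀ u ∈ K, ‖T u - T x‖ ≤ r := fun u hu =>
        (hT u (hCK hu) x (hCK hx)).trans (norm_sub_rev u x ▸ hxr u hu)
      -- Minimality is used a second time: the ball about `T x` contains `T u` for every `u ∈ K`,
      -- hence all of `K`.
      have hLK : K ∩ {u | ‖u - T x‖ ≤ r} = K := by
        refine hK.eq_of_invariantSubset Set.inter_subset_left ⟨T x, hTx, hL x hx⟩ ?_ ?_ ?_
        · exact hK.1.isClosed.inter (isClosed_le (by fun_prop) (by fun_prop))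
        · exact hK.1.convex.inter (convex_setOf_norm_sub_le _ _)
        · exact fun u hu => ⟨hK.1.mapsTo hu.1, hL u hu.1⟩
      intro u hu
      rw [← hLK] at hu
      exact (norm_sub_rev (T x) u).trans_le hu.2
  intro u hu v hv
  rw [← key] at hu
  exact Set.mem_iInter₂.1 hu.2 v hv

/-- The Goebel–Karlovitz lemma: an approximate fixed point sequence in a minimal invariant set
cannot stay close to a point of the set. -/
theorem norm_sub_le_of_approx_fixed (𝕜 : Type*) [RCLike 𝕜] [NormedSpace 𝕜 E]
    {T : E → E} {C K : Set E} (hC : IsCompact (toWeakSpace 𝕜 E '' K))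
    (hK : Minimal (IsInvariantSubset T C) K) (hT : ∀ x ∈ C, ∀ y ∈ C, ‖T x - T y‖ ≤ ‖x - y‖)
    {z : ℕ → E} (hz : ∀ k, z k ∈ K) (hTz : Tendsto (fun k => ‖T (z k) - z k‖) atTop (𝓝 0))
    {x : E} (hx : x ∈ K) {r : ℝ} (hr : ∀ k, ‖z k - x‖ ≤ r) :
    ∀ u ∈ K, ∀ v ∈ K, ‖u - v‖ ≤ r := by
  have hCK := hK.1.subset
  -- The condition says `limsup ‖z k - u‖ ≤ r`; it passes from `u` to `T u` because `z` is
  -- asymptotically fixed.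
  have key : {u | u ∈ K ∧ ∀ ε > 0, ∀ᶠ k in atTop, ‖z k - u‖ ≤ r + ε} = K := by
    refine hK.eq_of_invariantSubset (fun x hx => hx.1)
      ⟨x, hx, fun ε hε => .of_forall fun k => (hr k).trans (by linarith)⟩ ?_ ?_ ?_
    · refine isClosed_of_closure_subset fun u hu => ?_
      have huK : u ∈ K := closure_minimal (fun x hx => hx.1) hK.1.isClosed hu
      refine ⟨huK, fun ε hε => ?_⟩
      obtain ⟨v, hv, huv⟩ := Metric.mem_closure_iff.1 hu (ε / 2) (half_pos hε)
      filter_upwards [hv.2 (ε / 2) (half_pos hε)] with k hk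
      rw [dist_eq_norm, norm_sub_rev] at huv
      have := norm_sub_le_norm_sub_add_norm_sub (z k) v u
      linarith
    · rintro u ⟨hu, hu'⟩ v ⟨hv, hv'⟩ a b ha hb hab
      refine ⟨hK.1.convex hu hv ha hb hab, fun ε hε => ?_⟩
      filter_upwards [hu' ε hε, hv' ε hε] with k h1 h2
      rw [norm_sub_rev] at h1 h2 ⊢
      exact convex_setOf_norm_sub_le (z k) (r + ε) h1 h2 ha hb hab
    · rintro u ⟨hu, hu'⟩
      refine ⟨hK.1.mapsTo hu, fun ε hε => ?_⟩
      filter_upwards [hu' (ε / 2) (half_pos hε), hTz.eventually_lt_const (half_pos hε)]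
        with k h1 h2
      have h3 := hT (z k) (hCK (hz k)) u (hCK hu)
      have h4 := norm_sub_le_norm_sub_add_norm_sub (z k) (T (z k)) (T u)
      rw [norm_sub_rev] at h2
      linarith
  -- By lower semicontinuity the weak limit `y` lies within `r` of all of `K`, so diametrality
  -- applies at `y`.
  obtain ⟨y, hy, hlim⟩ := exists_weak_limit_of_isCompact hC (hyperfilter ℕ) z hz
  refine norm_sub_le_of_minimal hK hT hy fun u hu => ?_
  rw [norm_sub_rev]
  rw [← key] at hu
  refine norm_le_of_weak_limit (𝕜 := 𝕜) (l := (hyperfilter ℕ : Filter ℕ)) (u := fun n => z n - u)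
    (fun f => ?_) fun ε hε => ?_
  · simpa only [map_sub] using (hlim f).sub_const (f u)
  · exact Nat.hyperfilter_le_atTop (hu.2 ε hε)

theorem exists_fixed_point_of_convex_combination [CompleteSpace E] {T : E → E} {K : Set E}
    (hcl : IsClosed K) (hconv : Convex ℝ K) (hmaps : Set.MapsTo T K K)
    (hT : ∀ x ∈ K, ∀ y ∈ K, ‖T x - T y‖ ≤ ‖x - y‖) {t : ℝ} (ht : 0 < t) (ht1 : t < 1)
    {w : E} (hw : w ∈ K) : ∃ z ∈ K, (1 - t) • T z + t • w = z := by
  have hm : Set.MapsTo (fun z => (1 - t) • T z + t • w) K K := fun z hz =>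
    hconv (hmaps hz) hw (by linarith) ht.le (by ring)
  have hcoe : ((1 - t).toNNReal : ℝ) = 1 - t := Real.coe_toNNReal _ (by linarith)
  have hcon : ContractingWith (1 - t).toNNReal (hm.restrict _ K K) := by
    refine ⟨?_, LipschitzWith.of_dist_le_mul ?_⟩
    · rw [← NNReal.coe_lt_coe, hcoe, NNReal.coe_one]
      linarith
    · rintro ⟨a, ha⟩ ⟨b, hb⟩
      simp only [Subtype.dist_eq, Set.MapsTo.val_restrict_apply, dist_add_right, hcoe]
      rw [dist_eq_norm, ← smul_sub, norm_smul, Real.norm_of_nonneg (by linarith), dist_eq_norm]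
      exact mul_le_mul_of_nonneg_left (hT a ha b hb) (by linarith)
  obtain ⟨z, hz, hfix, -⟩ := hcon.exists_fixedPoint' hcl.isComplete hm hw (edist_ne_top _ _)
  exact ⟨z, hz, hfix⟩

end MinimalSets

/-! ### From the weak* UKK property to the García-Falset bound. -/

/-- The conclusion that the García-Falset coefficient of `E` is less than two, for sequences that
are weakly null along an ultrafilter. -/
theorem exists_norm_add_le_of_dualWeakStarUKK {𝕜 X E : Type*} [RCLike 𝕜] [NormedAddCommGroup X]
    [NormedSpace 𝕜 X] [NormedAddCommGroup E] [NormedSpace 𝕜 E]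
    (hseq : DualBallWeakStarSeqCompact 𝕜 X) (hUKK : DualWeakStarUKK 𝕜 X)
    (π : X →L[𝕜] E) (hπ : ‖π‖ ≤ 1) (hlift : ∀ e : E, ∀ c, ‖e‖ < c → ∃ x, π x = e ∧ ‖x‖ < c) :
    ∃ η : ℝ, 0 < η ∧ ∀ (U : Ultrafilter ℕ) (u : ℕ → E) (y : E), (∀ n, ‖u n‖ ≤ 1) → ‖y‖ ≤ 1 →
      (∀ f : StrongDual 𝕜 E, Tendsto (fun n => f (u n)) U (𝓝 0)) → ∃ n, ‖u n + y‖ ≤ 2 - η := by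
  obtain ⟨δ, hδ, hδ'⟩ := hUKK (1 / 4) (by norm_num)
  set η : ℝ := min (δ / 4) (1 / 8) with hη
  have hη0 : 0 < η := lt_min (by linarith) (by norm_num)
  have hη1 : η ≤ δ / 4 := min_le_left _ _
  have hη2 : η ≤ 1 / 8 := min_le_right _ _
  refine ⟨η, hη0, fun U u y hu hy hnull => ?_⟩
  by_contra! hcon
  choose f hf hfv using fun n => exists_dual_vector'' 𝕜 (u n + y)
  have hre : ∀ n, 2 - η < RCLike.re (f n (u n)) + RCLike.re (f n y) := fun n => by
    rw [← map_add, ← map_add, hfv n, RCLike.ofReal_re]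
    exact hcon n
  have hbound : ∀ n (v : E), ‖v‖ ≤ 1 → RCLike.re (f n v) ≤ 1 := fun n v hv =>
    (RCLike.re_le_norm _).trans (((f n).le_of_opNorm_le (hf n) v).trans (by linarith))
  have hfu : ∀ n, 1 - η < RCLike.re (f n (u n)) := fun n => by
    linarith [hre n, hbound n y hy]
  have hfy : ∀ n, 1 - η < RCLike.re (f n y) := fun n => by
    linarith [hre n, hbound n (u n) (hu n)]
  -- Weak nullity lets each new vector be nearly annihilated by the finitely many functionals
  -- already chosen.
  obtain ⟨k, -, hk⟩ := exists_seq_of_forall_finset_exists (fun _ : ℕ => True)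
    (fun i j => ‖f i (u j)‖ < 1 / 8) (fun s _ => by
      have h : ∀ i ∈ s, ∀ᶠ j in (U : Filter ℕ), ‖f i (u j)‖ < 1 / 8 := fun i _ => by
        have := (hnull (f i)).norm
        rw [norm_zero] at this
        exact this.eventually_lt_const (by norm_num)
      obtain ⟨j, hj⟩ := ((Filter.eventually_all_finset s).2 h).exists
      exact ⟨j, trivial, hj⟩)
  obtain ⟨g', hg', φ, hφ, hlim⟩ := hseq (x := fun i => StrongDual.toWeakDual ((f (k i)).comp π))
    (fun i => by
      rw [Set.mem_preimage, mem_closedBall_zero_iff]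
      exact ((f (k i)).opNorm_comp_le π).trans
        (mul_le_one₀ (hf _) (norm_nonneg _) hπ))
  obtain ⟨g, rfl⟩ := StrongDual.toWeakDual.surjective g'
  -- Tested on a lift of `u (k b)` of norm below `9 / 8`, the difference has modulus above `7 / 8 -
  -- 1 / 8`.
  have hsep : ∀ a b : ℕ, a < b →
      1 / 2 ≤ ‖(f (k a)).comp π - (f (k b)).comp π‖ := fun a b hab => by
    obtain ⟨x, hx, hxn⟩ := hlift (u (k b)) (9 / 8) ((hu _).trans_lt (by norm_num))
    have h1 := ((f (k a)).comp π - (f (k b)).comp π).le_opNorm x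
    have h2 : ((f (k a)).comp π - (f (k b)).comp π) x = f (k a) (u (k b)) - f (k b) (u (k b)) := by
      simp [hx]
    rw [h2] at h1
    have h3 := hk a b hab
    have h4 := hfu (k b)
    have h5 := RCLike.re_le_norm (f (k b) (u (k b)))
    have h6 := norm_sub_norm_le (f (k b) (u (k b))) (f (k a) (u (k b)))
    rw [norm_sub_rev] at h6
    nlinarith [norm_nonneg ((f (k a)).comp π - (f (k b)).comp π)]
  have hg := hδ' (fun i => (f (k (φ i))).comp π) g
    (fun i => by
      rw [mem_closedBall_zero_iff]
      exact ((f (k (φ i))).opNorm_comp_le π).trans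
        (mul_le_one₀ (hf _) (norm_nonneg _) hπ)) hlim
    (by
      refine lt_of_lt_of_le (b := 1 / 2) (by norm_num) (le_csInf ⟨_, 0, 1, by norm_num, rfl⟩ ?_)
      rintro _ ⟨m, n, hmn, rfl⟩
      rcases lt_or_gt_of_ne hmn with h | h
      · rw [norm_sub_rev]
        exact hsep _ _ (hφ h)
      · exact hsep _ _ (hφ h))
  -- Now `1 - η ≤ ‖g‖ * (1 + η)`, incompatible with `‖g‖ < 1 - δ` since `η ≤ δ / 4`.
  obtain ⟨x, hx, hxn⟩ := hlift y (1 + η) (by linarith)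
  have h1 : Tendsto (fun i => f (k (φ i)) y) atTop (𝓝 (g x)) := by
    have := ((WeakDual.eval_continuous x).tendsto _).comp hlim
    simpa [Function.comp_def, hx] using this
  have h2 : 1 - η ≤ RCLike.re (g x) :=
    ge_of_tendsto ((RCLike.continuous_re.tendsto _).comp h1) (.of_forall fun i => (hfy _).le)
  have h3 := (RCLike.re_le_norm (g x)).trans (g.le_opNorm x)
  nlinarith [norm_nonneg g, norm_nonneg x]

/-! ### From the García-Falset bound to fixed points. -/

section ConvexCombination

variable {E : Type*} [NormedAddCommGroup E] [NormedSpace ℝ E] {t : ℝ} {a b z z' w w' x : E}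

theorem norm_sub_le_of_convex_combination (ht : 0 ≤ t) (hz : (1 - t) • a + t • w = z) :
    ‖a - z‖ ≤ t * ‖a - w‖ := by
  have : a - z = t • (a - w) := by rw [← hz]; module
  rw [this, norm_smul, Real.norm_of_nonneg ht]

theorem norm_sub_le_of_convex_combinations (ht1 : t ≤ 1) (ht : 0 < t)
    (hz : (1 - t) • a + t • w = z) (hz' : (1 - t) • b + t • w' = z')
    (h : ‖a - b‖ ≤ ‖z - z'‖) : ‖z - z'‖ ≤ ‖w - w'‖ := by
  have h1 : z - z' = (1 - t) • (a - b) + t • (w - w') := by rw [← hz, ← hz']; module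
  have h2 := norm_add_le ((1 - t) • (a - b)) (t • (w - w'))
  rw [← h1, norm_smul, norm_smul, Real.norm_of_nonneg ht.le,
    Real.norm_of_nonneg (sub_nonneg.2 ht1)] at h2
  have h3 := mul_le_mul_of_nonneg_left h (sub_nonneg.2 ht1)
  refine le_of_mul_le_mul_left ?_ ht
  linarith

/-- Used with `a = T z`, `b = T x`: when `x` is almost fixed, `z` is hardly farther from `x` than
`w` is, with error `‖T x - x‖ / t`. -/
theorem mul_norm_sub_le_of_convex_combination (ht1 : t ≤ 1) (ht : 0 ≤ t)
    (hz : (1 - t) • a + t • w = z) (h : ‖a - b‖ ≤ ‖z - x‖) :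
    t * ‖z - x‖ ≤ ‖b - x‖ + t * ‖w - x‖ := by
  have h1 : z - x = (1 - t) • (a - x) + t • (w - x) := by rw [← hz]; module
  have h2 := norm_add_le ((1 - t) • (a - x)) (t • (w - x))
  rw [← h1, norm_smul, norm_smul, Real.norm_of_nonneg ht,
    Real.norm_of_nonneg (sub_nonneg.2 ht1)] at h2
  have h3 := norm_sub_le_norm_sub_add_norm_sub a b x
  have h4 : (1 - t) * ‖a - x‖ ≤ (1 - t) * (‖z - x‖ + ‖b - x‖) :=
    mul_le_mul_of_nonneg_left (by linarith) (sub_nonneg.2 ht1)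
  nlinarith [mul_nonneg ht (norm_nonneg (b - x))]

end ConvexCombination

theorem weakFixedPointProperty_of_exists_norm_add_le {𝕜 E : Type*} [RCLike 𝕜]
    [NormedAddCommGroup E] [NormedSpace 𝕜 E] [NormedSpace ℝ E] [IsScalarTower ℝ 𝕜 E]
    [CompleteSpace E] {η : ℝ} (hη : 0 < η)
    (hE : ∀ (U : Ultrafilter ℕ) (u : ℕ → E) (y : E), (∀ n, ‖u n‖ ≤ 1) → ‖y‖ ≤ 1 →
      (∀ f : StrongDual 𝕜 E, Tendsto (fun n => f (u n)) U (𝓝 0)) → ∃ n, ‖u n + y‖ ≤ 2 - η) :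
    WeakFixedPointProperty 𝕜 E := by
  classical
  intro C hne hC hconv T₀ hT₀
  set T : E → E := fun x => if h : x ∈ C then T₀ ⟨x, h⟩ else x with hTdef
  have hTC : ∀ x (h : x ∈ C), T x = T₀ ⟨x, h⟩ := fun x h => dif_pos h
  have hmaps : Set.MapsTo T C C := fun x hx => by rw [hTC x hx]; exact (T₀ ⟨x, hx⟩).2
  have hT : ∀ x ∈ C, ∀ y ∈ C, ‖T x - T y‖ ≤ ‖x - y‖ := fun x hx y hy => by
    rw [hTC x hx, hTC y hy]
    simpa [Subtype.dist_eq, dist_eq_norm] using hT₀.dist_le_mul ⟨x, hx⟩ ⟨y, hy⟩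
  obtain ⟨K, hK⟩ := exists_minimal_invariantSubset 𝕜 hne hC hconv hmaps
  have hCK := hK.1.subset
  have hKmaps := hK.1.mapsTo
  have hKT : ∀ x ∈ K, ∀ y ∈ K, ‖T x - T y‖ ≤ ‖x - y‖ := fun x hx y hy =>
    hT x (hCK hx) y (hCK hy)
  have hKc : IsCompact (toWeakSpace 𝕜 E '' K) := hC.of_isClosed_subset
    (isClosed_toWeakSpace_image hK.1.isClosed hK.1.convex) (Set.image_mono hCK)
  have hKb := isBounded_of_isCompact_toWeakSpace hKc
  have hdiam : ∀ u ∈ K, ∀ v ∈ K, ‖u - v‖ ≤ diam K := fun u hu v hv =>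
    dist_eq_norm u v ▸ dist_le_diam_of_mem hKb hu hv
  obtain ⟨p, hp⟩ := hK.1.nonempty
  rcases (diam_nonneg (s := K)).eq_or_lt with hd | hd
  · refine ⟨⟨p, hCK hp⟩, Subtype.ext ?_⟩
    rw [← hTC p (hCK hp)]
    exact sub_eq_zero.1 (norm_le_zero_iff.1 ((hdiam _ (hKmaps hp) _ hp).trans hd.ge))
  exfalso
  set d := diam K
  have hpos : ∀ k : ℕ, (0 : ℝ) < 1 / ((k : ℝ) + 2) := fun k => by positivity
  have hlt : ∀ k : ℕ, 1 / ((k : ℝ) + 2) < 1 := fun k => by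
    rw [div_lt_one (by positivity)]
    linarith [(Nat.cast_nonneg k : (0 : ℝ) ≤ k)]
  have hzero : Tendsto (fun k : ℕ => 1 / ((k : ℝ) + 2)) atTop (𝓝 0) := by
    simpa [Function.comp_def] using
      (tendsto_const_div_atTop_nhds_zero_nat (1 : ℝ)).comp (tendsto_add_atTop_nat 2)
  have happrox : ∀ z : ℕ → E, (∀ k, z k ∈ K) →
      (∀ k : ℕ, ∃ w ∈ K, (1 - 1 / ((k : ℝ) + 2)) • T (z k) + (1 / ((k : ℝ) + 2)) • w = z k) →
      Tendsto (fun k => ‖T (z k) - z k‖) atTop (𝓝 0) := fun z hz hw => by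
    refine squeeze_zero (fun k => norm_nonneg _) (fun k => ?_) (zero_mul d ▸ hzero.mul_const d)
    obtain ⟨w, hw, hwz⟩ := hw k
    refine (norm_sub_le_of_convex_combination (hpos k).le hwz).trans ?_
    exact mul_le_mul_of_nonneg_left (hdiam _ (hKmaps (hz k)) _ hw) (hpos k).le
  have hfix := fun (k : ℕ) (w : E) (hw : w ∈ K) => exists_fixed_point_of_convex_combination
    hK.1.isClosed hK.1.convex hKmaps hKT (hpos k) (hlt k) hw
  choose x hxK hx using fun k => hfix k p hp
  have hTx := happrox x hxK fun k => ⟨p, hp, hx k⟩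
  let U := hyperfilter ℕ
  obtain ⟨x₀, hx₀, hxlim⟩ := exists_weak_limit_of_isCompact hKc U x hxK
  -- For fixed `t`, perturbing `T` towards the midpoints of `x n` and `x₀` keeps the `z n` within `d
  -- / 2` of each other and, asymptotically, of `x n`. So their weak limit `y` is within `d / 2` of
  -- `x₀` and of each `z n`, and the bound applies to `z n - y` and `y - x₀` rescaled by `2 / d`.
  have key : ∀ k : ℕ, ∃ z ∈ K, (∃ w ∈ K,
      (1 - 1 / ((k : ℝ) + 2)) • T z + (1 / ((k : ℝ) + 2)) • w = z) ∧
      ‖z - x₀‖ ≤ (2 - η) * (d / 2) := fun k => by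
    set t : ℝ := 1 / ((k : ℝ) + 2)
    have ht : 0 < t := hpos k
    have ht1 : t < 1 := hlt k
    have hwK : ∀ n, midpoint ℝ (x n) x₀ ∈ K := fun n => hK.1.convex.midpoint_mem (hxK n) hx₀
    choose z hzK hz using fun n => hfix k _ (hwK n)
    obtain ⟨y, hy, hzlim⟩ := exists_weak_limit_of_isCompact hKc U z hzK
    have hyx : ‖y - x₀‖ ≤ d / 2 := by
      refine norm_le_of_weak_limit (𝕜 := 𝕜) (l := (U : Filter ℕ)) (u := fun n => z n - x n)
        (fun f => ?_) fun ε hε => ?_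
      · simpa only [map_sub] using (hzlim f).sub (hxlim f)
      · refine Nat.hyperfilter_le_atTop ?_
        filter_upwards [hTx.eventually_lt_const (mul_pos ht hε)] with n hn
        have h1 := mul_norm_sub_le_of_convex_combination ht1.le ht.le (hz n)
          (hKT _ (hzK n) _ (hxK n))
        have h2 : ‖midpoint ℝ (x n) x₀ - x n‖ ≤ d / 2 := by
          rw [← dist_eq_norm, dist_midpoint_left, Real.norm_ofNat, dist_eq_norm]
          linarith [hdiam _ (hxK n) _ hx₀]
        have h3 := mul_le_mul_of_nonneg_left h2 ht.le
        refine le_of_mul_le_mul_left ?_ ht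
        linarith
    have hzy : ∀ n, ‖z n - y‖ ≤ d / 2 := fun n => by
      rw [norm_sub_rev]
      refine norm_le_of_weak_limit (𝕜 := 𝕜) (l := (U : Filter ℕ)) (u := fun m => z m - z n)
        (fun f => ?_) fun ε hε => .of_forall fun m => ?_
      · simpa only [map_sub] using (hzlim f).sub_const (f (z n))
      · have h1 := norm_sub_le_of_convex_combinations ht1.le ht (hz m) (hz n)
          (hKT _ (hzK m) _ (hzK n))
        have h2 : ‖midpoint ℝ (x m) x₀ - midpoint ℝ (x n) x₀‖ ≤ d / 2 := by
          rw [← vsub_eq_sub, midpoint_vsub_midpoint, vsub_eq_sub, vsub_eq_sub, sub_self,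
            midpoint_eq_smul_add, add_zero, norm_smul]
          norm_num
          linarith [hdiam _ (hxK m) _ (hxK n)]
        linarith
    set c : 𝕜 := ((2 / d : ℝ) : 𝕜)
    have hc : ∀ v : E, ‖c • v‖ = 2 / d * ‖v‖ := fun v => by
      rw [norm_smul, RCLike.norm_ofReal, abs_of_pos (by positivity)]
    have hc1 : ∀ v : E, ‖v‖ ≤ d / 2 → ‖c • v‖ ≤ 1 := fun v hv => by
      rw [hc, div_mul_eq_mul_div, div_le_one hd]
      linarith
    obtain ⟨n, hn⟩ := hE U (fun n => c • (z n - y)) (c • (y - x₀)) (fun n => hc1 _ (hzy n))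
      (hc1 _ hyx) (fun f => by
        simpa using ((hzlim f).sub_const (f y)).const_mul c)
    refine ⟨z n, hzK n, ⟨_, hwK n, hz n⟩, ?_⟩
    rw [← smul_add, sub_add_sub_cancel, hc, div_mul_eq_mul_div, div_le_iff₀ hd] at hn
    linarith
  choose z hzK hz hzx using key
  have hle := norm_sub_le_of_approx_fixed 𝕜 hKc hK hT hzK (happrox z hzK hz) hx₀ hzx
  have : d ≤ (2 - η) * (d / 2) := diam_le_of_forall_dist_le
    ((norm_nonneg _).trans (hle p hp p hp)) fun u hu v hv => dist_eq_norm u v ▸ hle u hu v hv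
  nlinarith [mul_pos hη hd]

theorem weakFixedPointProperty_quotient {𝕜 X : Type*} [RCLike 𝕜] [NormedAddCommGroup X]
    [NormedSpace 𝕜 X] [NormedSpace ℝ X] [IsScalarTower ℝ 𝕜 X] [CompleteSpace X]
    (hseq : DualBallWeakStarSeqCompact 𝕜 X) (hUKK : DualWeakStarUKK 𝕜 X)
    (Y : Submodule 𝕜 X) [IsClosed (Y : Set X)] : WeakFixedPointProperty 𝕜 (X ⧸ Y) := by
  obtain ⟨η, hη, h⟩ := exists_norm_add_le_of_dualWeakStarUKK (E := X ⧸ Y) hseq hUKK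
    (Y.mkQ.mkContinuous 1 fun x => by simpa using Submodule.Quotient.norm_mk_le Y x)
    (LinearMap.mkContinuous_norm_le _ zero_le_one _)
    (fun e c hc => by
      obtain ⟨x, hx, hxc⟩ := Submodule.Quotient.norm_mk_lt e (sub_pos.2 hc)
      exact ⟨x, hx, by linarith⟩)
  exact weakFixedPointProperty_of_exists_norm_add_le hη h

/-! ### The space `c₀`. -/

namespace ZeroAtInftyContinuousMap

variable {𝕜 : Type*} [RCLike 𝕜]

/-- A sequence tending to zero, as an element of `c₀`. -/
def ofTendsto (f : ℕ → 𝕜) (hf : Tendsto f atTop (𝓝 0)) : C₀(ℕ, 𝕜) where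
  toFun := f
  continuous_toFun := continuous_of_discreteTopology
  zero_at_infty' := by rwa [cocompact_eq_cofinite, Nat.cofinite_eq_atTop]

theorem tendsto_atTop (x : C₀(ℕ, 𝕜)) : Tendsto x atTop (𝓝 0) := by
  have := x.zero_at_infty'
  rwa [cocompact_eq_cofinite, Nat.cofinite_eq_atTop] at this

theorem norm_apply_le (x : C₀(ℕ, 𝕜)) (n : ℕ) : ‖x n‖ ≤ ‖x‖ := by
  rw [← norm_toBCF_eq_norm]
  exact x.toBCF.norm_coe_le_norm n

theorem norm_le_of_forall {x : C₀(ℕ, 𝕜)} {r : ℝ} (hr : 0 ≤ r) (h : ∀ n, ‖x n‖ ≤ r) :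
    ‖x‖ ≤ r := by
  rw [← norm_toBCF_eq_norm]
  exact (BoundedContinuousFunction.norm_le hr).2 h

/-- The unit vectors of `c₀`. -/
def unitVec (𝕜 : Type*) [RCLike 𝕜] (i : ℕ) : C₀(ℕ, 𝕜) :=
  ofTendsto (fun n => if n = i then 1 else 0)
    (tendsto_const_nhds.congr' (by
      filter_upwards [eventually_gt_atTop i] with n hn
      rw [if_neg hn.ne']))

theorem unitVec_apply (i n : ℕ) : unitVec 𝕜 i n = if n = i then 1 else 0 := rfl

/-- The truncation of a null sequence to its first `N` terms. -/
def trunc (N : ℕ) (x : C₀(ℕ, 𝕜)) : C₀(ℕ, 𝕜) := ∑ i ∈ Finset.range N, x i • unitVec 𝕜 i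

theorem sum_apply {ι : Type*} (s : Finset ι) (g : ι → C₀(ℕ, 𝕜)) (n : ℕ) :
    (∑ i ∈ s, g i) n = ∑ i ∈ s, g i n := by
  classical
  induction s using Finset.induction_on with
  | empty => simp
  | insert a s ha ih => rw [Finset.sum_insert ha, Finset.sum_insert ha, add_apply, ih]

theorem trunc_apply (N : ℕ) (x : C₀(ℕ, 𝕜)) (n : ℕ) :
    trunc N x n = if n < N then x n else 0 := by
  simp [trunc, sum_apply, unitVec_apply]

theorem tendsto_trunc (x : C₀(ℕ, 𝕜)) : Tendsto (fun N => trunc N x) atTop (𝓝 x) := by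
  rw [Metric.tendsto_atTop]
  intro ε hε
  obtain ⟨N, hN⟩ := Metric.tendsto_atTop.1 x.tendsto_atTop (ε / 2) (half_pos hε)
  refine ⟨N, fun M hM => ?_⟩
  rw [dist_eq_norm]
  refine (norm_le_of_forall (half_pos hε).le fun n => ?_).trans_lt (half_lt_self hε)
  rw [sub_apply, trunc_apply]
  split_ifs with h
  · simpa using (half_pos hε).le
  · have := hN n (by omega)
    rw [dist_zero_right] at this
    simpa using this.le

/-- Needed for weak* sequential compactness of the dual ball. -/
instance separableSpace : TopologicalSpace.SeparableSpace C₀(ℕ, 𝕜) := by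
  have h : TopologicalSpace.IsSeparable
      (closure (Submodule.span 𝕜 (Set.range (unitVec 𝕜)) : Set C₀(ℕ, 𝕜))) :=
    ((Set.countable_range _).isSeparable.span).closure
  rw [← TopologicalSpace.isSeparable_univ_iff]
  refine h.mono fun x _ => mem_closure_of_tendsto x.tendsto_trunc (.of_forall fun N => ?_)
  exact Submodule.sum_mem _ fun i _ => Submodule.smul_mem _ _ (Submodule.subset_span ⟨i, rfl⟩)

/-- A head and a tail have disjoint supports, so after aligning phases their sum stays in the unit
ball. -/
theorem norm_apply_trunc_add_le (f : StrongDual 𝕜 C₀(ℕ, 𝕜)) (N : ℕ) {x y : C₀(ℕ, 𝕜)}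
    (hx : ‖x‖ ≤ 1) (hy : ‖y‖ ≤ 1) : ‖f (trunc N x)‖ + ‖f (y - trunc N y)‖ ≤ ‖f‖ := by
  have hunit : ∀ a : 𝕜, ∃ c : 𝕜, ‖c‖ ≤ 1 ∧ c * a = (‖a‖ : ℝ) := fun a => by
    obtain ⟨g, hg, hga⟩ := exists_dual_vector'' 𝕜 a
    refine ⟨g 1, (g.le_of_opNorm_le hg 1).trans (by simp), ?_⟩
    rw [← hga, mul_comm, ← smul_eq_mul, ← map_smul, smul_eq_mul, mul_one]
  obtain ⟨a, ha, ha'⟩ := hunit (f (trunc N x))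
  obtain ⟨b, hb, hb'⟩ := hunit (f (y - trunc N y))
  have hn : ‖a • trunc N x + b • (y - trunc N y)‖ ≤ 1 := by
    refine norm_le_of_forall zero_le_one fun n => ?_
    simp only [add_apply, smul_apply, sub_apply, trunc_apply, smul_eq_mul]
    split_ifs
    · simpa using mul_le_one₀ ha (norm_nonneg _) ((x.norm_apply_le n).trans hx)
    · simpa using mul_le_one₀ hb (norm_nonneg _) ((y.norm_apply_le n).trans hy)
  have h := (f.le_opNorm _).trans (mul_le_of_le_one_right (norm_nonneg f) hn)
  rw [map_add, map_smul, map_smul, smul_eq_mul, smul_eq_mul, ha', hb', ← RCLike.ofReal_add,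
    RCLike.norm_ofReal] at h
  exact (le_abs_self _).trans h

/-- All but `η` of `‖g‖` sits on finitely many coordinates, where `f n → g` in norm; this leaves at
most `1 - ‖g‖ + η` for the tail of `f n` and `η` for that of `g`. -/
theorem norm_sub_le_of_tendsto {f : ℕ → StrongDual 𝕜 C₀(ℕ, 𝕜)} {g : StrongDual 𝕜 C₀(ℕ, 𝕜)}
    (hf : ∀ n, ‖f n‖ ≤ 1) (hlim : ∀ x, Tendsto (fun n => f n x) atTop (𝓝 (g x)))
    {η : ℝ} (hη : 0 < η) : ∀ᶠ n in atTop, ‖f n - g‖ ≤ 1 - ‖g‖ + 3 * η := by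
  obtain ⟨ξ, hξ, hgξ⟩ : ∃ ξ, ‖ξ‖ ≤ 1 ∧ ‖g‖ - η < ‖g ξ‖ := by
    by_contra! hcon
    have h0 : 0 ≤ ‖g‖ - η := (norm_nonneg _).trans (hcon 0 (by simp))
    have := ContinuousLinearMap.opNorm_le_of_unit_norm h0 fun v hv => hcon v hv.le
    linarith
  obtain ⟨N, hN⟩ : ∃ N, ‖g‖ - η < ‖g (trunc N ξ)‖ :=
    (((g.continuous.tendsto _).comp ξ.tendsto_trunc).norm.eventually_const_lt hgξ).exists
  have hsum : Tendsto (fun n => ∑ i ∈ Finset.range N, ‖f n (unitVec 𝕜 i) - g (unitVec 𝕜 i)‖)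
      atTop (𝓝 0) := by
    have := tendsto_finsetSum (Finset.range N) fun i _ =>
      ((hlim (unitVec 𝕜 i)).sub_const (g (unitVec 𝕜 i))).norm
    simpa using this
  filter_upwards [hsum.eventually_lt_const hη, (hlim (trunc N ξ)).norm.eventually_const_lt hN]
    with n h1 h2
  have hg1 : ‖g‖ - η ≤ 1 := by
    have := norm_apply_trunc_add_le (f n) N hξ (y := 0) (by simp)
    linarith [hf n, norm_nonneg ((f n) (0 - trunc N 0))]
  refine ContinuousLinearMap.opNorm_le_of_unit_norm (by linarith) fun v hv => ?_
  have h3 := norm_apply_trunc_add_le (f n) N hξ hv.le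
  have h4 := norm_apply_trunc_add_le g N hξ hv.le
  have h5 : ‖(f n - g) (trunc N v)‖ ≤
      ∑ i ∈ Finset.range N, ‖f n (unitVec 𝕜 i) - g (unitVec 𝕜 i)‖ := by
    rw [trunc, map_sum]
    refine (norm_sum_le _ _).trans (Finset.sum_le_sum fun i _ => ?_)
    rw [map_smul, norm_smul]
    exact mul_le_of_le_one_left (norm_nonneg _) ((v.norm_apply_le i).trans hv.le)
  have h6 : (f n - g) v = (f n - g) (trunc N v) + f n (v - trunc N v) - g (v - trunc N v) := by
    simp only [map_sub, _root_.sub_apply]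
    ring
  rw [h6]
  have h7 := norm_sub_le ((f n - g) (trunc N v) + f n (v - trunc N v)) (g (v - trunc N v))
  have h8 := norm_add_le ((f n - g) (trunc N v)) (f n (v - trunc N v))
  linarith [hf n]

theorem dualWeakStarUKK : DualWeakStarUKK 𝕜 C₀(ℕ, 𝕜) := by
  intro ε hε
  -- Two late terms give `ε < 2 * (1 - ‖g‖) + 6 * (ε / 24)`, hence `‖g‖ < 1 - 3 * ε / 8`.
  refine ⟨ε / 4, by positivity, fun f g hf hlim hsep => ?_⟩
  have hf' : ∀ n, ‖f n‖ ≤ 1 := fun n => mem_closedBall_zero_iff.1 (hf n)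
  have hlim' : ∀ x, Tendsto (fun n => f n x) atTop (𝓝 (g x)) := fun x =>
    ((WeakDual.eval_continuous x).tendsto _).comp hlim
  obtain ⟨N, hN⟩ := eventually_atTop.1
    (norm_sub_le_of_tendsto hf' hlim' (η := ε / 24) (by positivity))
  have h1 := hN N le_rfl
  have h2 := hN (N + 1) (by omega)
  have h3 : sepConst f ≤ ‖f N - f (N + 1)‖ :=
    csInf_le ⟨0, by rintro _ ⟨m, n, -, rfl⟩; exact norm_nonneg _⟩ ⟨N + 1, N, by omega, rfl⟩
  have h4 := norm_sub_le_norm_sub_add_norm_sub (f N) g (f (N + 1))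
  rw [norm_sub_rev g] at h4
  linarith

theorem dualBallWeakStarSeqCompact : DualBallWeakStarSeqCompact 𝕜 C₀(ℕ, 𝕜) :=
  WeakDual.isSeqCompact_closedBall 𝕜 C₀(ℕ, 𝕜) 0 1

end ZeroAtInftyContinuousMap

theorem mainTheorem2 (𝕜 : Type*) [RCLike 𝕜] :
    (∀ (X : Type*) [NormedAddCommGroup X] [NormedSpace 𝕜 X] [NormedSpace ℝ X]
        [IsScalarTower ℝ 𝕜 X] [CompleteSpace X],
      DualBallWeakStarSeqCompact 𝕜 X → DualWeakStarUKK 𝕜 X →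
        ∀ (Y : Submodule 𝕜 X) [IsClosed (Y : Set X)], WeakFixedPointProperty 𝕜 (X ⧸ Y)) ∧
    (∀ (Z : Submodule 𝕜 C₀(ℕ, 𝕜)) [IsClosed (Z : Set C₀(ℕ, 𝕜))],
      WeakFixedPointProperty 𝕜 (C₀(ℕ, 𝕜) ⧸ Z)) := by
  refine ⟨fun X _ _ _ _ _ hseq hUKK Y _ => weakFixedPointProperty_quotient hseq hUKK Y,
    fun Z _ => ?_⟩
  exact weakFixedPointProperty_quotient ZeroAtInftyContinuousMap.dualBallWeakStarSeqCompact
    ZeroAtInftyContinuousMap.dualWeakStarUKK Z
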